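/- Let $s \ge 1$ and $d, n, N$ be natural numbers. A one-layer Transformer with head size $s$ and hidden width $q$ maps $Z \in \mathbb{R}^{d\times n}$ to $\mathcal{F}(Z) = \mathcal{F}^{(FF)}(\mathcal{F}^{(SA)}_S(Z))$, where $$\mathcal{F}^{(SA)}_S(Z) = Z + W^{(O)}(W^{(V)}Z)\,\sigma_S\big[(W^{(K)}Z)^\top (W^{(Q)}Z)\big], \qquad \mathcal{F}^{(FF)}(H)_{:,k} = H_{:,k} + W^{(2)}\sigma_R\big[W^{(1)}H_{:,k}+b^{(1)}\big] + b^{(2)} \quad (1 \le k \le n),$$ with $W^{(O)}\in\mathbb{R}^{d\times s}$, $W^{(V)},W^{(K)},W^{(Q)}\in\mathbb{R}^{s\times d}$, $W^{(1)}\in\mathbb{R}^{q\times d}$, $W^{(2)}\in\mathbb{R}^{d\times q}$, $b^{(1)}\in\mathbb{R}^q$, $b^{(2)}\in\mathbb{R}^d$; here $\sigma_S$ is the column-wise softmax and $\sigma_R$ the entrywise ReLU. An architecture with $P$ parameters is such a Transformer in which each of the four attention matrices is an outer product of a vector in $\mathbb{R}^s$ and a vector in $\mathbb{R}^d$ (contributing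 $s+d$ parameters each), and each entry of $W^{(1)}, b^{(1)}, W^{(2)}, b^{(2)}$ is either fixed to $0$ or equal to one of $p$ real parameters (one parameter may be shared by several entries), where $P = 4(s+d)+p$; the choice of $q$, $p$ and of which entry is $0$ or carries which parameter belongs to the architecture. Then there is an architecture, depending only on $s, d, n, N$, with at most $4(s+d)+d(2nN+d)$ parameters, such that the following holds for all $C \in \mathbb{N}$, $\epsilon>0$, $r_{\max}>r_{\min}>0$ and all input-output pairs $(X^{(1)},Y^{(1)}),\dots,(X^{(N)},Y^{(N)})\in\mathbb{R}^{d\times n}\times\{1,\dots,C\}^{d\times n}$. Suppose that 1. (tokenwise $(r_{\min},r_{\max},\epsilon)$-separated) $r_{\min} < \|X^{(i)}_{:,k}\| < r_{\max}$ for all $i,k$, and $\|X^{(i)}_{:,k}-X^{(j)}_{:,l}\|>\epsilon$ for all $i,j,k,l$ with $X^{(i)}_{:,k}\ne X^{(j)}_{:,l}$, in the Euclidean norm; 2. (no duplicate token) $X^{(i)}_{:,k}\ne X^{(i)}_{:,l}$ for all $i$ and all $k\ne l$; 3. (consistent labels) $Y^{(i)}_{:,k}=Y^{(j)}_{:,l}$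 whenever $X^{(i)}_{:,k}=X^{(j)}_{:,l}$ and $\mathcal{V}^{(i)}=\mathcal{V}^{(j)}$, where $\mathcal{V}^{(i)}=\{X^{(i)}_{:,1},\dots,X^{(i)}_{:,n}\}$. Then there are values of the parameters for which $\mathcal{F}(X^{(i)})=Y^{(i)}$ for every $i=1,\dots,N$. -/

import Mathlib

open scoped Matrix

noncomputable section

namespace OneLayerTransformer

/-- The `k`-th token (column) of a sequence, as a vector with the Euclidean norm. -/
def token {d n : ℕ} (Z : Matrix (Fin d) (Fin n) ℝ) (k : Fin n) : EuclideanSpace ℝ (Fin d) :=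
  WithLp.toLp 2 (fun a => Z a k)

/-- The vocabulary set of a sequence: the set of its tokens. -/
def vocabulary {d n : ℕ} (Z : Matrix (Fin d) (Fin n) ℝ) : Set (EuclideanSpace ℝ (Fin d)) :=
  Set.range (token Z)

/-- Tokenwise `(rmin, rmax, δ)`-separated sequences. -/
structure TokenwiseSeparated {m n N : ℕ} (rmin rmax δ : ℝ)
    (Z : Fin N → Matrix (Fin m) (Fin n) ℝ) : Prop where
  lower : ∀ i k, rmin < ‖token (Z i) k‖
  upper : ∀ i k, ‖token (Z i) k‖ < rmax
  separated : ∀ i j k l, token (Z i) k ≠ token (Z j) l →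
    δ < ‖token (Z i) k - token (Z j) l‖

/-- No sequence contains the same token at two different positions. -/
def NoDuplicateToken {d n N : ℕ} (X : Fin N → Matrix (Fin d) (Fin n) ℝ) : Prop :=
  ∀ i k l, k ≠ l → token (X i) k ≠ token (X i) l

/-- Equal tokens of sequences with equal vocabularies carry equal label vectors. -/
def ConsistentlyLabeled {d n N : ℕ} (X : Fin N → Matrix (Fin d) (Fin n) ℝ)
    (Y : Fin N → Matrix (Fin d) (Fin n) ℕ) : Prop :=
  ∀ i j k l, vocabulary (X i) = vocabulary (X j) → token (X i) k = token (X j) l →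
    ∀ a, Y i a k = Y j a l

/-- Column-wise softmax. -/
def colSoftmax {m n : ℕ} (A : Matrix (Fin m) (Fin n) ℝ) : Matrix (Fin m) (Fin n) ℝ :=
  Matrix.of fun k l => Real.exp (A k l) / ∑ k', Real.exp (A k' l)

/-- Single-head softmax self-attention with skip connection. -/
def selfAttention {s d n : ℕ} (WO : Matrix (Fin d) (Fin s) ℝ) (WV WK WQ : Matrix (Fin s) (Fin d) ℝ)
    (Z : Matrix (Fin d) (Fin n) ℝ) : Matrix (Fin d) (Fin n) ℝ :=
  Z + WO * (WV * Z) * colSoftmax ((WK * Z)ᵀ * (WQ * Z))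

/-- Token-wise feed-forward block with one hidden ReLU layer of width `q` and skip connection. -/
def feedForward {d q n : ℕ} (W1 : Matrix (Fin q) (Fin d) ℝ) (b1 : Fin q → ℝ)
    (W2 : Matrix (Fin d) (Fin q) ℝ) (b2 : Fin d → ℝ)
    (H : Matrix (Fin d) (Fin n) ℝ) : Matrix (Fin d) (Fin n) ℝ :=
  Matrix.of fun a k =>
    H a k + (W2 *ᵥ fun r => max ((W1 *ᵥ fun c => H c k) r + b1 r) 0) a + b2 a

/-- A one-layer single-head Transformer architecture with head size `s` and embedding
dimension `d`. Each of the four attention matrices is of rank at most one and is stored as an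
outer product of two vectors (`s + d` parameters). In the feed-forward block, every weight or
bias entry is either fixed to zero (`none`) or read from one of `ffParams` trainable scalars
(`some t`); one scalar may be used at several entries (weight sharing). -/
structure Architecture (s d : ℕ) where
  hidden : ℕ
  ffParams : ℕ
  W1 : Matrix (Fin hidden) (Fin d) (Option (Fin ffParams))
  b1 : Fin hidden → Option (Fin ffParams)
  W2 : Matrix (Fin d) (Fin hidden) (Option (Fin ffParams))
  b2 : Fin d → Option (Fin ffParams)

namespace Architecture

variable {s d : ℕ} (A : Architecture s d)

/-- Index set of the trainable scalars: for each of the four attention matrices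
(`0`: output, `1`: value, `2`: key, `3`: query) a vector of length `s` and one of length `d`,
and the scalars of the feed-forward block. -/
abbrev ParamIndex : Type := (Fin 4 × (Fin s ⊕ Fin d)) ⊕ Fin A.ffParams

/-- The number of parameters. -/
def numParams : ℕ := Fintype.card A.ParamIndex

theorem numParams_eq : A.numParams = 4 * (s + d) + A.ffParams := by
  simp [numParams]

variable (θ : A.ParamIndex → ℝ)

/-- The length-`s` factor of the attention matrix number `w`. -/
def headVec (w : Fin 4) : Fin s → ℝ := fun r => θ (Sum.inl (w, Sum.inl r))

/-- The length-`d` factor of the attention matrix number `w`. -/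
def embedVec (w : Fin 4) : Fin d → ℝ := fun c => θ (Sum.inl (w, Sum.inr c))

/-- The value of a feed-forward entry. -/
def entry (o : Option (Fin A.ffParams)) : ℝ := o.elim 0 fun t => θ (Sum.inr t)

/-- The Transformer block computed by the architecture with parameter vector `θ`:
self-attention followed by the feed-forward block. -/
def eval {n : ℕ} (Z : Matrix (Fin d) (Fin n) ℝ) : Matrix (Fin d) (Fin n) ℝ :=
  feedForward (A.W1.map (A.entry θ)) (fun r => A.entry θ (A.b1 r))
    (A.W2.map (A.entry θ)) (fun a => A.entry θ (A.b2 a))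
    (selfAttention
      (Matrix.vecMulVec (A.embedVec θ 0) (A.headVec θ 0))
      (Matrix.vecMulVec (A.headVec θ 1) (A.embedVec θ 1))
      (Matrix.vecMulVec (A.headVec θ 2) (A.embedVec θ 2))
      (Matrix.vecMulVec (A.headVec θ 3) (A.embedVec θ 3)) Z)

end Architecture

end OneLayerTransformer

end

/-! With rank-one weights whose head factors are one basis vector, attention adds to each token `x`
a multiple of a fixed vector `u`: the softmax mean of the numbers `v ⬝ᵥ x_m` at inverse temperature
`t * (v ⬝ᵥ x)`. That mean is the logarithmic derivative of `∑ exp (τ * a_m)`, and by independence of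
characters this sum determines the set of the `a_m`. The mean is analytic, so a generic `t` tells
different vocabularies apart, while a small `u` keeps different tokens apart
(`exists_contextual_mapping`). By consistency the labels are then a function of the attention
output. A generic linear form `p` sends these outputs injectively to the line, where one ReLU neuron
per token interpolates. All neurons share `p`, so `d + M + d * M` feed-forward parameters suffice
for `M = N * n`. -/

/-- Finitely many points of the line can be mapped to prescribed values by a ReLU network with one
hidden neuron for each point. -/
theorem exists_relu_interpolation {ι E : Type*} [Fintype ι] [AddCommGroup E] [Module ℝ E]
    (t : ι → ℝ) (y : ι → E) (h : ∀ i j, t i = t j → y i = y j) :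
    ∃ (b : ι → ℝ) (w : ι → E), ∀ j, ∑ i, max (t j + b i) 0 • w i = y j := by
  classical
  suffices H : ∀ S : Finset ι, ∃ (b : ι → ℝ) (w : ι → E),
      ∀ j ∈ S, ∑ i ∈ S, max (t j + b i) 0 • w i = y j by
    obtain ⟨b, w, hbw⟩ := H Finset.univ
    exact ⟨b, w, fun j => hbw j (Finset.mem_univ j)⟩
  intro S
  -- Points are added from left to right, so a new neuron can be inactive at all earlier points.
  induction S using Finset.induction_on_max_value t with
  | empty => exact ⟨0, 0, by simp⟩
  | insert i S hi hmax ih =>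
    obtain ⟨b, w, hbw⟩ := ih
    have key : ∀ (c : ℝ) (e : E) (x : ℝ),
        ∑ k ∈ insert i S, max (x + Function.update b i c k) 0 • Function.update w i e k =
          max (x + c) 0 • e + ∑ k ∈ S, max (x + b k) 0 • w k := by
      intro c e x
      rw [Finset.sum_insert hi, Function.update_self, Function.update_self]
      congr 1
      refine Finset.sum_congr rfl fun k hk => ?_
      have hki : k ≠ i := fun hk' => hi (hk' ▸ hk)
      rw [Function.update_of_ne hki, Function.update_of_ne hki]
    by_cases hex : ∃ j ∈ S, t j = t i
    · obtain ⟨j, hj, hji⟩ := hex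
      refine ⟨Function.update b i 0, Function.update w i 0, fun k hk => ?_⟩
      rw [key, smul_zero, zero_add]
      rcases Finset.mem_insert.1 hk with rfl | hk
      · rw [← hji, hbw j hj, h _ _ hji]
      · exact hbw k hk
    · push Not at hex
      have hlt : ∀ j ∈ S, t j < t i := fun j hj => lt_of_le_of_ne (hmax j hj) (hex j hj)
      obtain ⟨c, hc, hci⟩ : ∃ c, (∀ j ∈ S, t j ≤ c) ∧ c < t i := by
        rcases S.eq_empty_or_nonempty with rfl | hS
        · exact ⟨t i - 1, by simp, by linarith⟩
        · exact ⟨S.sup' hS t, fun j hj => Finset.le_sup' t hj, (Finset.sup'_lt_iff hS).2 hlt⟩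
      -- The new neuron switches on at `c`; its weight corrects the error left at `t i`.
      refine ⟨Function.update b i (-c), Function.update w i
        ((t i - c)⁻¹ • (y i - ∑ k ∈ S, max (t i + b k) 0 • w k)), fun k hk => ?_⟩
      rw [key]
      rcases Finset.mem_insert.1 hk with rfl | hk
      · rw [← sub_eq_add_neg, max_eq_left (by linarith), smul_inv_smul₀ (by linarith),
          sub_add_cancel]
      · rw [max_eq_right (by linarith [hc k hk]), zero_smul, zero_add, hbw k hk]

/-- A linear form that vanishes on none of finitely many nonzero vectors. -/
theorem exists_dotProduct_ne_zero {ι : Type*} [Finite ι] {d : ℕ} (x : ι → Fin d → ℝ)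
    (P : ι → Prop) (h : ∀ i, P i → x i ≠ 0) : ∃ v : Fin d → ℝ, ∀ i, P i → v ⬝ᵥ x i ≠ 0 := by
  obtain ⟨f, hf⟩ := Module.exists_dual_forall_apply_ne_zero (K := ℝ)
    (fun i : {i // P i} => x i) (fun i => h i i.2)
  refine ⟨fun c => f (Pi.single c 1), fun i hi => ?_⟩
  have := hf ⟨i, hi⟩
  rwa [LinearMap.pi_apply_eq_sum_univ f, show ∑ c, x i c • f (fun j => if c = j then 1 else 0)
    = (fun c => f (Pi.single c 1)) ⬝ᵥ x i from ?_] at this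
  refine Finset.sum_congr rfl fun c _ => ?_
  rw [smul_eq_mul, mul_comm]
  congr 2
  ext j
  simp [Pi.single_apply, eq_comm]

/-! ### Exponential sums and softmax means -/

/-- The coefficients count multiplicities, so they cannot cancel. -/
theorem mem_range_iff_sum_single_ne_zero {ι : Type*} [Fintype ι] (a : ι → ℝ) (x : ℝ) :
    x ∈ Set.range a ↔ (∑ m, Finsupp.single (a m) (1 : ℝ)) x ≠ 0 := by
  classical
  rw [Finsupp.finsetSum_apply, Ne, Finset.sum_eq_zero_iff_of_nonneg]
  · simp [Finsupp.single_apply]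
  · intro i _
    rw [Finsupp.single_apply]
    split_ifs <;> norm_num

/-- A sum of exponentials determines its set of exponents. -/
theorem range_eq_of_sum_exp_eq {ι κ : Type*} [Fintype ι] [Fintype κ] (a : ι → ℝ) (b : κ → ℝ)
    (h : ∀ t : ℝ, ∑ m, Real.exp (t * a m) = ∑ m, Real.exp (t * b m)) :
    Set.range a = Set.range b := by
  classical
  -- Distinct exponents give distinct characters of the additive reals, which are linearly
  -- independent.
  let e : ℝ → (Multiplicative ℝ →* ℝ) := fun x =>
    { toFun := fun t => Real.exp (t.toAdd * x)
      map_one' := by simp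
      map_mul' := fun s t => by simp [add_mul, Real.exp_add] }
  have he : Function.Injective e := by
    intro x y hxy
    have := DFunLike.congr_fun hxy (Multiplicative.ofAdd 1)
    simpa [e] using this
  have hli := (linearIndependent_monoidHom (Multiplicative ℝ) ℝ).comp e he
  have hsum : (∑ m, Finsupp.single (a m) (1 : ℝ)) = ∑ m, Finsupp.single (b m) (1 : ℝ) := by
    apply hli
    ext t
    simpa [map_sum, Finsupp.linearCombination_single, e] using h t.toAdd
  ext x
  rw [mem_range_iff_sum_single_ne_zero, mem_range_iff_sum_single_ne_zero, hsum]

/-- The mean of `a` with respect to the softmax weights of `t * a`. -/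
noncomputable def softmaxMean {ι : Type*} [Fintype ι] (a : ι → ℝ) (t : ℝ) : ℝ :=
  (∑ m, a m * Real.exp (t * a m)) / ∑ m, Real.exp (t * a m)

theorem hasDerivAt_sum_exp_mul {ι : Type*} [Fintype ι] (a : ι → ℝ) (t : ℝ) :
    HasDerivAt (fun t => ∑ m, Real.exp (t * a m)) (∑ m, a m * Real.exp (t * a m)) t := by
  refine HasDerivAt.fun_sum fun m _ => ?_
  simpa [mul_comm] using ((hasDerivAt_id t).mul_const (a m)).exp

section softmaxMean

variable {ι κ : Type*} [Fintype ι] [Nonempty ι] [Fintype κ] [Nonempty κ]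

theorem sum_exp_mul_pos (a : ι → ℝ) (t : ℝ) : 0 < ∑ m, Real.exp (t * a m) :=
  Finset.sum_pos (fun _ _ => Real.exp_pos _) Finset.univ_nonempty

theorem analyticOnNhd_softmaxMean (a : ι → ℝ) :
    AnalyticOnNhd ℝ (softmaxMean a) Set.univ := by
  have hexp : ∀ c : ℝ, AnalyticOnNhd ℝ (fun t : ℝ => Real.exp (t * c)) Set.univ :=
    fun c t _ => (analyticAt_id.mul analyticAt_const).rexp
  have hsum : ∀ w : ι → ℝ,
      AnalyticOnNhd ℝ (fun t : ℝ => ∑ m, w m * Real.exp (t * a m)) Set.univ := fun w =>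
    Finset.univ.analyticOnNhd_fun_sum fun m _ => analyticOnNhd_const.mul (hexp (a m))
  refine (hsum a).div ?_ fun t _ => (sum_exp_mul_pos a t).ne'
  simpa using hsum 1

/-- The softmax mean is a logarithmic derivative, hence it determines the set of exponents. -/
theorem range_eq_of_softmaxMean_eq (hcard : Fintype.card ι = Fintype.card κ) (a : ι → ℝ)
    (b : κ → ℝ) (h : softmaxMean a = softmaxMean b) : Set.range a = Set.range b := by
  apply range_eq_of_sum_exp_eq
  -- Equal logarithmic derivatives make the quotient constant; at `0` it is a ratio of equal
  -- cardinalities.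
  have hd : ∀ t, HasDerivAt
      (fun t => (∑ m, Real.exp (t * a m)) / ∑ m, Real.exp (t * b m)) 0 t := by
    intro t
    have hb := (sum_exp_mul_pos b t).ne'
    refine ((hasDerivAt_sum_exp_mul a t).div (hasDerivAt_sum_exp_mul b t) hb).congr_deriv ?_
    have := congrFun h t
    rw [softmaxMean, softmaxMean, div_eq_div_iff (sum_exp_mul_pos a t).ne' hb] at this
    rw [this]
    simp [mul_comm]
  intro t
  have hconst := is_const_of_deriv_eq_zero (fun t => (hd t).differentiableAt)
    (fun t => (hd t).deriv) t 0
  have hκ : (Fintype.card κ : ℝ) ≠ 0 := Nat.cast_ne_zero.2 Fintype.card_ne_zero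
  simpa [hcard, hκ, div_eq_iff (sum_exp_mul_pos b t).ne'] using hconst

-- Identity theorem: analytic functions agreeing at points accumulating at `0` agree everywhere.
open Filter Topology in
theorem eventually_softmaxMean_ne (hcard : Fintype.card ι = Fintype.card κ) (a : ι → ℝ)
    (b : κ → ℝ) (h : Set.range a ≠ Set.range b) {c : ℝ} (hc : c ≠ 0) :
    ∀ᶠ t in 𝓝[≠] (0 : ℝ), softmaxMean a (t * c) ≠ softmaxMean b (t * c) := by
  have hlin : AnalyticOnNhd ℝ (fun t : ℝ => t * c) Set.univ :=
    fun _ _ => analyticAt_id.mul analyticAt_const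
  have ha : AnalyticOnNhd ℝ (fun t : ℝ => softmaxMean a (t * c)) Set.univ :=
    (analyticOnNhd_softmaxMean a).comp hlin (Set.mapsTo_univ _ _)
  have hb : AnalyticOnNhd ℝ (fun t : ℝ => softmaxMean b (t * c)) Set.univ :=
    (analyticOnNhd_softmaxMean b).comp hlin (Set.mapsTo_univ _ _)
  refine ((ha 0 trivial).eventually_eq_or_eventually_ne (hb 0 trivial)).resolve_left fun hev => h ?_
  refine range_eq_of_softmaxMean_eq hcard a b (funext fun t => ?_)
  simpa [hc] using congrFun (ha.eq_of_eventuallyEq hb hev) (t / c)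

end softmaxMean

/-! ### Contextual mapping -/

open Filter Topology in
/-- Attention with rank-one weights separates tokens together with their vocabularies: it is a
contextual mapping on finitely many sequences of nonzero tokens. -/
theorem exists_contextual_mapping {κ ι : Type*} [Finite κ] [Fintype ι] {d : ℕ} [NeZero d]
    (x : κ → ι → Fin d → ℝ) (hx : ∀ i k, x i k ≠ 0) :
    ∃ (u v : Fin d → ℝ) (s : ℝ), ∀ i j k l,
      x i k + softmaxMean (fun m => v ⬝ᵥ x i m) (s * (v ⬝ᵥ x i k)) • u =
        x j l + softmaxMean (fun m => v ⬝ᵥ x j m) (s * (v ⬝ᵥ x j l)) • u →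
      x i k = x j l ∧ Set.range (x i) = Set.range (x j) := by
  classical
  obtain ⟨v, hv⟩ := exists_dotProduct_ne_zero
    (fun p : (κ × ι) ⊕ ((κ × ι) × (κ × ι)) =>
      p.elim (fun p => x p.1 p.2) fun p => x p.1.1 p.1.2 - x p.2.1 p.2.2)
    (fun p => p.elim (fun _ => True) fun p => x p.1.1 p.1.2 ≠ x p.2.1 p.2.2) (by
      rintro (p | p) hp
      · exact hx _ _
      · exact sub_ne_zero.2 hp)
  have hv0 : ∀ i k, v ⬝ᵥ x i k ≠ 0 := fun i k => hv (Sum.inl (i, k)) trivial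
  have hvinj : ∀ i j k l, v ⬝ᵥ x i k = v ⬝ᵥ x j l → x i k = x j l := by
    intro i j k l h
    by_contra hne
    apply hv (Sum.inr ((i, k), (j, l))) hne
    simp [dotProduct_sub, h]
  have hrange : ∀ i j, Set.range (fun m => v ⬝ᵥ x i m) = Set.range (fun m => v ⬝ᵥ x j m) →
      Set.range (x i) = Set.range (x j) := by
    have hsub : ∀ i j, Set.range (fun m => v ⬝ᵥ x i m) ⊆ Set.range (fun m => v ⬝ᵥ x j m) →
        Set.range (x i) ⊆ Set.range (x j) := by
      rintro i j h _ ⟨k, rfl⟩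
      obtain ⟨l, hl⟩ := h ⟨k, rfl⟩
      exact ⟨l, hvinj _ _ _ _ hl⟩
    exact fun i j h => (hsub i j h.le).antisymm (hsub j i h.ge)
  -- Equal tokens issue equal queries, so vocabularies need only be separated at a common, nonzero
  -- query value.
  obtain ⟨s, hs⟩ : ∃ s : ℝ, ∀ p : κ × κ × ι, Set.range (x p.1) ≠ Set.range (x p.2.1) →
      softmaxMean (fun m => v ⬝ᵥ x p.1 m) (s * (v ⬝ᵥ x p.1 p.2.2)) ≠
        softmaxMean (fun m => v ⬝ᵥ x p.2.1 m) (s * (v ⬝ᵥ x p.1 p.2.2)) := by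
    refine (eventually_all.2 fun p => ?_ : ∀ᶠ s in 𝓝[≠] (0 : ℝ), _).exists
    have : Nonempty ι := ⟨p.2.2⟩
    rw [eventually_imp_distrib_left]
    exact fun h => eventually_softmaxMean_ne rfl _ _ (mt (hrange _ _) h) (hv0 _ _)
  set g : κ → ι → ℝ := fun i k => softmaxMean (fun m => v ⬝ᵥ x i m) (s * (v ⬝ᵥ x i k))
  -- At `c = 0` distinct tokens stay distinct; by continuity this persists for small nonzero `c`.
  obtain ⟨c, hc, hc0⟩ : ∃ c : ℝ, (∀ p : (κ × ι) × (κ × ι), x p.1.1 p.1.2 ≠ x p.2.1 p.2.2 →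
      x p.1.1 p.1.2 + g p.1.1 p.1.2 • (fun _ => c) ≠
        x p.2.1 p.2.2 + g p.2.1 p.2.2 • (fun _ => c)) ∧ c ≠ 0 := by
    refine (Eventually.and ?_ (eventually_mem_nhdsWithin : ∀ᶠ c in 𝓝[≠] (0 : ℝ), c ∈ _)).exists
    refine eventually_all.2 fun p => ?_
    apply eventually_nhdsWithin_of_eventually_nhds
    rw [eventually_imp_distrib_left]
    intro h
    have hcont : ∀ (y : Fin d → ℝ) (r : ℝ),
        Continuous fun c : ℝ => y + r • (fun _ : Fin d => c) := fun y r => by fun_prop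
    refine ((hcont _ _).continuousAt.ne_iff_eventually_ne (hcont _ _).continuousAt).1 ?_
    intro h0
    apply h
    ext a
    simpa using congrFun h0 a
  refine ⟨fun _ => c, v, s, fun i j k l h => ?_⟩
  have hxx : x i k = x j l := by
    by_contra hne
    exact hc ((i, k), (j, l)) hne h
  refine ⟨hxx, ?_⟩
  by_contra hne
  apply hs (i, j, k) hne
  have h0 := congrFun h 0
  simp only [hxx, Pi.add_apply, Pi.smul_apply, smul_eq_mul, add_right_inj,
    mul_left_inj' hc0] at h0
  simpa [hxx] using h0

/-! ### Realization by an architecture -/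

namespace OneLayerTransformer

theorem selfAttention_vecMulVec {s d n : ℕ} (r : Fin s) (u v w z : Fin d → ℝ)
    (Z : Matrix (Fin d) (Fin n) ℝ) (a : Fin d) (k : Fin n) :
    selfAttention (Matrix.vecMulVec u (Pi.single r 1)) (Matrix.vecMulVec (Pi.single r 1) v)
      (Matrix.vecMulVec (Pi.single r 1) w) (Matrix.vecMulVec (Pi.single r 1) z) Z a k =
      Z a k + u a * ((∑ m, (v ⬝ᵥ Z.col m) * Real.exp ((w ⬝ᵥ Z.col m) * (z ⬝ᵥ Z.col k))) /
        ∑ m, Real.exp ((w ⬝ᵥ Z.col m) * (z ⬝ᵥ Z.col k))) := by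
  have hmul : ∀ (y : Fin d → ℝ) (q : Fin s) (m : Fin n),
      (Matrix.vecMulVec (Pi.single r 1) y * Z) q m =
        (Pi.single r 1 : Fin s → ℝ) q * (y ⬝ᵥ Z.col m) := by
    intro y q m
    simp [Matrix.mul_apply, Matrix.vecMulVec_apply, dotProduct, Finset.mul_sum, mul_assoc]
  have hlogit : ∀ m, ((Matrix.vecMulVec (Pi.single r 1) w * Z)ᵀ *
      (Matrix.vecMulVec (Pi.single r 1) z * Z)) m k = (w ⬝ᵥ Z.col m) * (z ⬝ᵥ Z.col k) := by
    intro m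
    rw [Matrix.mul_apply]
    simp [Matrix.transpose_apply, -Matrix.transpose_mul, hmul, Pi.single_apply]
  have hval : ∀ m, (Matrix.vecMulVec u (Pi.single r 1) *
      (Matrix.vecMulVec (Pi.single r 1) v * Z)) a m = u a * (v ⬝ᵥ Z.col m) := by
    intro m
    rw [Matrix.mul_apply]
    simp [hmul, Matrix.vecMulVec_apply, Pi.single_apply]
  rw [selfAttention, Matrix.add_apply, Matrix.mul_apply]
  congr 1
  simp only [hval, colSoftmax, Matrix.of_apply, hlogit, Finset.sum_div, Finset.mul_sum]
  exact Finset.sum_congr rfl fun m _ => by ring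

/-- The architecture whose hidden neurons all read the input through one common linear form. -/
noncomputable def sharedProjection (s d M : ℕ) : Architecture s d where
  hidden := M
  ffParams := Fintype.card (Fin d ⊕ Fin M ⊕ Fin d × Fin M)
  W1 := Matrix.of fun _ c => some (Fintype.equivFin _ (Sum.inl c))
  b1 := fun r => some (Fintype.equivFin _ (Sum.inr (Sum.inl r)))
  W2 := Matrix.of fun a r => some (Fintype.equivFin _ (Sum.inr (Sum.inr (a, r))))
  b2 := fun _ => none

theorem sharedProjection_numParams_le {s d M : ℕ} (hd : 0 < d) :
    (sharedProjection s d M).numParams ≤ 4 * (s + d) + d * (2 * M + d) := by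
  rw [Architecture.numParams_eq]
  have : (sharedProjection s d M).ffParams = d + (M + d * M) := by
    simp [sharedProjection]
  nlinarith [Nat.mul_le_mul_right M hd, Nat.mul_le_mul_right d hd]

theorem exists_eval_sharedProjection {s d M : ℕ} (r : Fin s) (u v w z p : Fin d → ℝ)
    (b : Fin M → ℝ) (W : Fin M → Fin d → ℝ) :
    ∃ θ : (sharedProjection s d M).ParamIndex → ℝ,
      ∀ (n : ℕ) (Z : Matrix (Fin d) (Fin n) ℝ) (k : Fin n),
        let h := Z.col k + ((∑ m, (v ⬝ᵥ Z.col m) * Real.exp ((w ⬝ᵥ Z.col m) * (z ⬝ᵥ Z.col k))) /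
          ∑ m, Real.exp ((w ⬝ᵥ Z.col m) * (z ⬝ᵥ Z.col k))) • u
        ((sharedProjection s d M).eval θ Z).col k =
          h + ∑ i, max (p ⬝ᵥ h + b i) 0 • W i := by
  let e := Fintype.equivFin (Fin d ⊕ Fin M ⊕ Fin d × Fin M)
  let f : Fin d ⊕ Fin M ⊕ Fin d × Fin M → ℝ := Sum.elim p (Sum.elim b fun x => W x.2 x.1)
  let θ : (sharedProjection s d M).ParamIndex → ℝ :=
    Sum.elim (fun x => x.2.elim (Pi.single r 1) (![u, v, w, z] x.1))
      (fun t => f (e.symm t))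
  refine ⟨θ, fun n Z k => ?_⟩
  intro h
  have hW1 : ∀ i c, (sharedProjection s d M).entry θ ((sharedProjection s d M).W1 i c) = p c :=
    fun i c => congrArg f (e.symm_apply_apply (Sum.inl c))
  have hb1 : ∀ i, (sharedProjection s d M).entry θ ((sharedProjection s d M).b1 i) = b i :=
    fun i => congrArg f (e.symm_apply_apply (Sum.inr (Sum.inl i)))
  have hW2 : ∀ a i, (sharedProjection s d M).entry θ ((sharedProjection s d M).W2 a i) = W i a :=
    fun a i => congrArg f (e.symm_apply_apply (Sum.inr (Sum.inr (a, i))))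
  have hb2 : ∀ a, (sharedProjection s d M).entry θ ((sharedProjection s d M).b2 a) = 0 :=
    fun a => rfl
  have hsa : ∀ a, selfAttention
      (Matrix.vecMulVec ((sharedProjection s d M).embedVec θ 0)
        ((sharedProjection s d M).headVec θ 0))
      (Matrix.vecMulVec ((sharedProjection s d M).headVec θ 1)
        ((sharedProjection s d M).embedVec θ 1))
      (Matrix.vecMulVec ((sharedProjection s d M).headVec θ 2)
        ((sharedProjection s d M).embedVec θ 2))
      (Matrix.vecMulVec ((sharedProjection s d M).headVec θ 3)
        ((sharedProjection s d M).embedVec θ 3))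
      Z a k = h a := fun a =>
    (selfAttention_vecMulVec r u v w z Z a k).trans (by simp [h, mul_comm])
  ext a
  simp only [Matrix.col_apply, Architecture.eval, feedForward, Matrix.of_apply, hsa, hb1, hb2,
    Matrix.mulVec, dotProduct, Matrix.map_apply, hW1, hW2, add_zero, Pi.add_apply,
    Finset.sum_apply, Pi.smul_apply, smul_eq_mul, mul_comm]
  rfl

end OneLayerTransformer

open OneLayerTransformer in
theorem corollary4 (s d n N : ℕ) (hs : 0 < s) :
    ∃ A : OneLayerTransformer.Architecture s d,
      A.numParams ≤ 4 * (s + d) + d * (2 * n * N + d) ∧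
      ∀ (C : ℕ) (rmin rmax ε : ℝ), 0 < ε → 0 < rmin → rmin < rmax →
      ∀ (X : Fin N → Matrix (Fin d) (Fin n) ℝ) (Y : Fin N → Matrix (Fin d) (Fin n) ℕ),
        (∀ i a k, Y i a k ∈ Set.Icc 1 C) →
        OneLayerTransformer.TokenwiseSeparated rmin rmax ε X →
        OneLayerTransformer.NoDuplicateToken X →
        OneLayerTransformer.ConsistentlyLabeled X Y →
        ∃ θ : A.ParamIndex → ℝ, ∀ i, A.eval θ (X i) = (Y i).map (fun y => (y : ℝ)) := by
  rcases Nat.eq_zero_or_pos d with rfl | hd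
  · refine ⟨⟨0, 0, fun _ _ => none, fun _ => none, fun _ _ => none, fun _ => none⟩,
      by simp [Architecture.numParams_eq], ?_⟩
    intro C rmin rmax ε _ _ _ X Y _ _ _ _
    exact ⟨0, fun i => Subsingleton.elim _ _⟩
  have : NeZero d := ⟨hd.ne'⟩
  refine ⟨sharedProjection s d (N * n), ?_, ?_⟩
  · simpa [mul_assoc, mul_comm n N] using sharedProjection_numParams_le (s := s) (M := N * n) hd
  intro C rmin rmax ε _ hrmin _ X Y _ hsep _ hlab
  have htoken : ∀ i j k l, (X i).col k = (X j).col l → token (X i) k = token (X j) l :=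
    fun i j k l h => congrArg (WithLp.toLp 2) h
  obtain ⟨u, v, t, hctx⟩ := exists_contextual_mapping (fun i k => (X i).col k) (by
    intro i k h0
    refine (hrmin.trans (hsep.lower i k)).ne' ?_
    rw [norm_eq_zero]
    exact congrArg (WithLp.toLp 2) h0)
  set H : Fin N × Fin n → Fin d → ℝ := fun q => (X q.1).col q.2 +
    softmaxMean (fun m => v ⬝ᵥ (X q.1).col m) (t * (v ⬝ᵥ (X q.1).col q.2)) • u
  have hlabH : ∀ p q, H p = H q → ∀ a, Y p.1 a p.2 = Y q.1 a q.2 := by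
    intro p q hpq
    obtain ⟨hcol, hrange⟩ := hctx p.1 q.1 p.2 q.2 hpq
    refine hlab _ _ _ _ ?_ (htoken _ _ _ _ hcol)
    have := congrArg (Set.image (WithLp.toLp 2)) hrange
    rwa [← Set.range_comp, ← Set.range_comp] at this
  obtain ⟨p, hp⟩ := exists_dotProduct_ne_zero
    (fun q : (Fin N × Fin n) × (Fin N × Fin n) => H q.1 - H q.2) (fun q => H q.1 ≠ H q.2)
    (fun _ h => sub_ne_zero.2 h)
  -- The skip connection already contributes `H q`, so the network fits the difference.
  obtain ⟨b, W, hW⟩ := exists_relu_interpolation (fun q => p ⬝ᵥ H q)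
    (fun q a => (Y q.1 a q.2 : ℝ) - H q a) (by
      intro q q' h
      have hHq : H q = H q' := by
        by_contra hne
        exact hp (q, q') hne (by simpa [dotProduct_sub, sub_eq_zero] using h)
      ext a
      rw [hlabH q q' hHq a, hHq])
  obtain ⟨θ, hθ⟩ := exists_eval_sharedProjection (⟨0, hs⟩ : Fin s) u v v (t • v) p
    (b ∘ finProdFinEquiv.symm) (W ∘ finProdFinEquiv.symm)
  refine ⟨θ, fun i => ?_⟩
  ext a k
  have hmean : (∑ m, (v ⬝ᵥ (X i).col m) *
        Real.exp ((v ⬝ᵥ (X i).col m) * (t • v ⬝ᵥ (X i).col k))) /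
      ∑ m, Real.exp ((v ⬝ᵥ (X i).col m) * (t • v ⬝ᵥ (X i).col k)) =
      softmaxMean (fun m => v ⬝ᵥ (X i).col m) (t * (v ⬝ᵥ (X i).col k)) := by
    simp only [softmaxMean, smul_dotProduct, smul_eq_mul, mul_comm]
  have hcol := hθ n (X i) k
  simp only [hmean] at hcol
  have hsum := hW (i, k)
  rw [← finProdFinEquiv.symm.sum_comp] at hsum
  have := congrFun (hcol.trans (congrArg (H (i, k) + ·) hsum)) a
  simpa using this
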